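/- Let $G$ be a discrete group acting by $*$-automorphisms $\alpha:G\to{\rm Aut}(A)$ on a unital C*-algebra $A$, with fixed point algebra $A^\alpha=\{a\in A:\alpha_t(a)=a\ \text{for all } t\in G\}$, and let $(\pi,u,H)$ be a covariant representation of $(G,A,\alpha)$: $\pi$ is a unital $*$-representation of $A$ and $u$ a unitary representation of $G$ on the same complex Hilbert space $H$, with $u_t\pi(a)u_t^*=\pi(\alpha_t(a))$ for all $t\in G$, $a\in A$. Write ${\rm Ad}_{u_g}(x)=u_gxu_g^*$, and let $A\rtimes_{\pi,u}G\subseteq B(H)$ be the C*-algebra generated by $\pi(A)\cup u(G)$. Let $\mathfrak M$ be the set of all unital completely positive maps $\phi:B(H)\to B(H)$ that commute with all ${\rm Ad}_{u_g}$ and restrict to the identity on $\pi(A^\alpha)$, ordered by $\phi\le\psi\iff\|\phi(x)\|\le\|\psi(x)\|$ for all $x\in B(H)$. Let $\phi$ be a minimal element of $\mathfrak M$. The boundary $\mathcal B_{\pi,u}={\rm Im}(\phi)$ is a C*-algebra under the Choi–Effros product $x\cdot y=\phi(xy)$ and the involution of $B(H)$; $G$ acts on it by $g\mapsto {\rm Ad}_{u_g}$,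 and it contains $\pi(A^\alpha)$. Let ${\rm Aut}_{\pi,u}(G)$ be the group of those $\tau\in{\rm Aut}(G)$ that extend to $A\rtimes_{\pi,u}G$, i.e. for which there is a $*$-automorphism $\theta$ of $A\rtimes_{\pi,u}G$ with $\theta(u_g)=u_{\tau(g)}$ for all $g\in G$ and $\theta(\pi(a))=\pi(a)$ for all $a\in A^\alpha$. It contains all inner automorphisms of $G$. Then the action of $G$ on $\mathcal B_{\pi,u}$ extends to an action $\tau\mapsto\hat\tau$ of ${\rm Aut}_{\pi,u}(G)$ on $\mathcal B_{\pi,u}$: there is a group homomorphism $\tau\mapsto\hat\tau$ from ${\rm Aut}_{\pi,u}(G)$ to the group of bijective unital completely isometric linear maps of $\mathcal B_{\pi,u}$ such that 1. $\hat\tau={\rm Ad}_{u_g}$ on $\mathcal B_{\pi,u}$ when $\tau$ is the inner automorphism $h\mapsto ghg^{-1}$, $g\in G$; 2. $\hat\tau(u_gxu_g^*)=u_{\tau(g)}\hat\tau(x)u_{\tau(g)}^*$ for all $\tau\in{\rm Aut}_{\pi,u}(G)$, $g\in G$, $x\in\mathcal B_{\pi,u}$; 3. $\hat\tau$ is the identity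 on $\pi(A^\alpha)$ for all $\tau\in{\rm Aut}_{\pi,u}(G)$. Moreover each $\hat\tau$ is a $*$-automorphism of the C*-algebra $\mathcal B_{\pi,u}$, and such a homomorphism with properties 1–3 is unique. -/

import Mathlib

open scoped CStarAlgebra

noncomputable section

namespace CovariantBoundary

/-- The fixed point algebra `A^α` of an action `α` of `G` on a unital C*-algebra `A`. -/
def fixedAlgebra {G A : Type*} [Group G] [CStarAlgebra A] (α : G →* (A ≃⋆ₐ[ℂ] A)) :
    StarSubalgebra ℂ A where
  carrier := {a | ∀ t, α t a = a}
  mul_mem' ha hb t := by rw [map_mul, ha t, hb t]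
  add_mem' ha hb t := by rw [map_add, ha t, hb t]
  algebraMap_mem' r t := by
    rw [Algebra.algebraMap_eq_smul_one, map_smul, map_one]
  star_mem' ha t := by rw [map_star, ha t]

/-- A covariant representation `(π, u, H)` of the C*-dynamical system `(G, A, α)` with `A` unital
and `G` discrete: a unital `*`-representation `π` of `A` and a unitary representation `u` of `G`
on the same Hilbert space `H` with `u_t π(a) u_t^* = π(α_t(a))`. -/
structure CovRep {G A : Type*} [Group G] [CStarAlgebra A] (α : G →* (A ≃⋆ₐ[ℂ] A))
    (H : Type*) [NormedAddCommGroup H] [InnerProductSpace ℂ H] [CompleteSpace H] where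
  /-- the representation of the C*-algebra -/
  π : A →⋆ₐ[ℂ] (H →L[ℂ] H)
  /-- the unitary representation of the group -/
  u : G →* unitary (H →L[ℂ] H)
  covariant : ∀ (t : G) (a : A),
    (u t : H →L[ℂ] H) * π a * star (u t : H →L[ℂ] H) = π (α t a)

/-- The group of bijective unital completely isometric linear maps of a subspace `V` of `B(H)`
(an operator system), under composition. The norm of a matrix over `B(H)` is its C*-norm. -/
def uciAut {H : Type*} [NormedAddCommGroup H] [InnerProductSpace ℂ H] [CompleteSpace H]
    (V : Submodule ℂ (H →L[ℂ] H)) : Subgroup (V ≃ₗ[ℂ] V) where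
  carrier := {T | (∀ v : V, (v : H →L[ℂ] H) = 1 → (T v : H →L[ℂ] H) = 1) ∧
    ∀ (n : ℕ) (M : Matrix (Fin n) (Fin n) V),
      ‖CStarMatrix.ofMatrix (M.map fun v => (T v : H →L[ℂ] H))‖ =
        ‖CStarMatrix.ofMatrix (M.map fun v => (v : H →L[ℂ] H))‖}
  mul_mem' := by
    rintro S T ⟨hS1, hS⟩ ⟨hT1, hT⟩
    exact ⟨fun v hv => hS1 _ (hT1 v hv), fun n M => (hS n (M.map T)).trans (hT n M)⟩
  one_mem' := ⟨fun _ hv => hv, fun _ _ => rfl⟩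
  inv_mem' := by
    rintro T ⟨hT1, hT⟩
    refine ⟨fun v hv => ?_, fun n M => ?_⟩
    · have h := hT1 v hv
      have h2 : T v = v := Subtype.ext (h.trans hv.symm)
      have h3 : T⁻¹ v = v := by
        change T.symm v = v
        rw [LinearEquiv.symm_apply_eq, h2]
      rw [h3, hv]
    · have h := hT n (M.map (T⁻¹ : V ≃ₗ[ℂ] V))
      have h2 : ((M.map (T⁻¹ : V ≃ₗ[ℂ] V)).map fun v => (T v : H →L[ℂ] H)) =
          M.map fun v => (v : H →L[ℂ] H) := by
        ext1 i j
        simp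
      rw [h2] at h
      exact h.symm

namespace CovRep

variable {G A H : Type*} [Group G] [CStarAlgebra A] {α : G →* (A ≃⋆ₐ[ℂ] A)}
  [NormedAddCommGroup H] [InnerProductSpace ℂ H] [CompleteSpace H] (R : CovRep α H)

/-- The action `Ad_{u_g}` of `G` on `B(H)`, `x ↦ u_g x u_g^*`. -/
def ad (g : G) (x : H →L[ℂ] H) : H →L[ℂ] H :=
  (R.u g : H →L[ℂ] H) * x * star (R.u g : H →L[ℂ] H)

/-- The set `𝔐` of all unital completely positive `G`-equivariant maps `B(H) → B(H)` which are the
identity on `π(A^α)`. -/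
def mapSet : Set ((H →L[ℂ] H) →CP (H →L[ℂ] H)) :=
  {φ | φ 1 = 1 ∧ (∀ g x, φ (R.ad g x) = R.ad g (φ x)) ∧
    ∀ a ∈ fixedAlgebra α, φ (R.π a) = R.π a}

/-- `φ` is a minimal element of `𝔐` for the order
`φ ≤ ψ ↔ ∀ x, ‖φ x‖ ≤ ‖ψ x‖`. -/
def IsMinimalMap (φ : (H →L[ℂ] H) →CP (H →L[ℂ] H)) : Prop :=
  φ ∈ R.mapSet ∧ ∀ ψ ∈ R.mapSet, (∀ x, ‖ψ x‖ ≤ ‖φ x‖) → ∀ x, ‖φ x‖ ≤ ‖ψ x‖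

/-- The image of a completely positive map on `B(H)`. For a minimal element `φ` of `𝔐` this is the
Furstenberg-Hamana boundary `𝓑_{π,u}`. -/
def boundary (φ : (H →L[ℂ] H) →CP (H →L[ℂ] H)) : Submodule ℂ (H →L[ℂ] H) :=
  LinearMap.range φ.toLinearMap

theorem apply_mem_boundary (φ : (H →L[ℂ] H) →CP (H →L[ℂ] H)) (x : H →L[ℂ] H) :
    φ x ∈ boundary φ := ⟨x, rfl⟩

theorem star_mem_boundary (φ : (H →L[ℂ] H) →CP (H →L[ℂ] H)) {x : H →L[ℂ] H}
    (hx : x ∈ boundary φ) : star x ∈ boundary φ := by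
  obtain ⟨y, rfl⟩ := hx
  exact ⟨star y, map_star φ y⟩

/-- The Choi-Effros product `x · y = φ(xy)` on the image of `φ`. -/
def choiEffrosMul (φ : (H →L[ℂ] H) →CP (H →L[ℂ] H)) (x y : boundary φ) : boundary φ :=
  ⟨φ ((x : H →L[ℂ] H) * (y : H →L[ℂ] H)), apply_mem_boundary φ _⟩

/-- The involution on the image of `φ`, inherited from `B(H)`. -/
def boundaryStar (φ : (H →L[ℂ] H) →CP (H →L[ℂ] H)) (x : boundary φ) : boundary φ :=
  ⟨star (x : H →L[ℂ] H), star_mem_boundary φ x.2⟩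

variable {R} in
theorem ad_mem_boundary {φ : (H →L[ℂ] H) →CP (H →L[ℂ] H)} (hφ : R.IsMinimalMap φ) (g : G)
    {x : H →L[ℂ] H} (hx : x ∈ boundary φ) : R.ad g x ∈ boundary φ := by
  obtain ⟨y, rfl⟩ := hx
  exact ⟨R.ad g y, hφ.1.2.1 g y⟩

variable {R} in
/-- The action `x ↦ u_g x u_g^*` of `g ∈ G` on the boundary. -/
def adBoundary {φ : (H →L[ℂ] H) →CP (H →L[ℂ] H)} (hφ : R.IsMinimalMap φ) (g : G)
    (x : boundary φ) : boundary φ :=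
  ⟨R.ad g x, ad_mem_boundary hφ g x.2⟩

variable {R} in
theorem pi_mem_boundary {φ : (H →L[ℂ] H) →CP (H →L[ℂ] H)} (hφ : R.IsMinimalMap φ) {a : A}
    (ha : a ∈ fixedAlgebra α) : R.π a ∈ boundary φ :=
  ⟨R.π a, hφ.1.2.2 a ha⟩

/-- The crossed product `A ⋊_{π,u} G`: as `A` is unital, it is the C*-subalgebra of `B(H)` generated
by `π(A) ∪ u(G)`. -/
def crossedProduct : StarSubalgebra ℂ (H →L[ℂ] H) :=
  (StarAlgebra.adjoin ℂ
    (Set.range R.π ∪ Set.range fun g => (R.u g : H →L[ℂ] H))).topologicalClosure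

theorem pi_mem (a : A) : R.π a ∈ R.crossedProduct :=
  StarSubalgebra.le_topologicalClosure _
    (StarAlgebra.subset_adjoin ℂ _ (Or.inl ⟨a, rfl⟩))

theorem u_mem (g : G) : (R.u g : H →L[ℂ] H) ∈ R.crossedProduct :=
  StarSubalgebra.le_topologicalClosure _
    (StarAlgebra.subset_adjoin ℂ _ (Or.inr ⟨g, rfl⟩))

/-- The `*`-automorphism `θ` of `A ⋊_{π,u} G` extends the automorphism `τ` of `G`:
`θ(u_g) = u_{τ(g)}`, and `θ` is the identity on `π(A^α)`. -/
def Extends (τ : MulAut G) (θ : R.crossedProduct ≃⋆ₐ[ℂ] R.crossedProduct) : Prop :=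
  (∀ g, θ ⟨R.u g, R.u_mem g⟩ = ⟨R.u (τ g), R.u_mem (τ g)⟩) ∧
    ∀ a ∈ fixedAlgebra α, θ ⟨R.π a, R.pi_mem a⟩ = ⟨R.π a, R.pi_mem a⟩

/-- The group `Aut_{π,u}(G)` of all automorphisms of `G` that extend to a `*`-automorphism of
`A ⋊_{π,u} G`. -/
def autGroup : Subgroup (MulAut G) where
  carrier := {τ | ∃ θ, R.Extends τ θ}
  mul_mem' := by
    rintro σ τ ⟨θ, h1, h2⟩ ⟨η, k1, k2⟩
    refine ⟨θ * η, fun g => ?_, fun a ha => ?_⟩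
    · change θ (η _) = _
      rw [k1, h1]
      rfl
    · change θ (η _) = _
      rw [k2 a ha, h2 a ha]
  one_mem' := ⟨1, fun _ => rfl, fun _ _ => rfl⟩
  inv_mem' := by
    rintro τ ⟨θ, h1, h2⟩
    refine ⟨θ⁻¹, fun g => ?_, fun a ha => ?_⟩
    · change θ.symm _ = _
      rw [StarAlgEquiv.symm_apply_eq, h1]
      simp
    · change θ.symm _ = _
      rw [StarAlgEquiv.symm_apply_eq, h2 a ha]

theorem conj_mem_autGroup (g : G) : MulAut.conj g ∈ R.autGroup := by
  let U : unitary R.crossedProduct :=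
    ⟨⟨R.u g, R.u_mem g⟩, by
      rw [Unitary.mem_iff]
      exact ⟨Subtype.ext (Unitary.coe_star_mul_self (R.u g)),
        Subtype.ext (Unitary.coe_mul_star_self (R.u g))⟩⟩
  refine ⟨Unitary.conjStarAlgAut ℂ _ U, fun h => ?_, fun a ha => ?_⟩
  · rw [Unitary.conjStarAlgAut_apply]
    refine Subtype.ext ?_
    change (R.u g : H →L[ℂ] H) * R.u h * star (R.u g : H →L[ℂ] H) = R.u (g * h * g⁻¹)
    rw [map_mul, map_mul, map_inv]
    rfl
  · rw [Unitary.conjStarAlgAut_apply]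
    refine Subtype.ext ?_
    change (R.u g : H →L[ℂ] H) * R.π a * star (R.u g : H →L[ℂ] H) = R.π a
    rw [R.covariant, ha g]

/-- The canonical homomorphism `G → Aut_{π,u}(G)` sending `g` to the inner automorphism
`h ↦ g h g⁻¹`. -/
def innerHom : G →* R.autGroup :=
  (MulAut.conj : G →* MulAut G).codRestrict R.autGroup R.conj_mem_autGroup

variable {R} in
/-- An action `ρ` of `Aut_{π,u}(G)` on the boundary (by bijective unital completely isometric maps)
extending the action of `G`: it restricts to `g ↦ Ad_{u_g}` along `G → Aut_{π,u}(G)`, satisfies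
`ρ_τ(u_g x u_g^*) = u_{τ(g)} ρ_τ(x) u_{τ(g)}^*`, and is trivial on `π(A^α)`. -/
structure IsExtendedAction {φ : (H →L[ℂ] H) →CP (H →L[ℂ] H)} (hφ : R.IsMinimalMap φ)
    (ρ : R.autGroup →* uciAut (boundary φ)) : Prop where
  extends_ad : ∀ (g : G) (x : boundary φ), (ρ (R.innerHom g)).1 x = adBoundary hφ g x
  equivariant : ∀ (τ : R.autGroup) (g : G) (x : boundary φ),
    (ρ τ).1 (adBoundary hφ g x) = adBoundary hφ (τ.1 g) ((ρ τ).1 x)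
  fixes : ∀ (τ : R.autGroup) (a : A) (ha : a ∈ fixedAlgebra α),
    (ρ τ).1 ⟨R.π a, pi_mem_boundary hφ ha⟩ = ⟨R.π a, pi_mem_boundary hφ ha⟩

end CovRep

end CovariantBoundary

end

open scoped CStarAlgebra
open scoped Matrix ComplexOrder

noncomputable section

namespace CovariantBoundary

/-! ### Unital contractions and positivity in C*-algebras. -/

section CStar

variable {M N : Type*} [CStarAlgebra M] [CStarAlgebra N]

/-! If τ extends to a `*`-automorphism θ of the crossed product, view θ as a representation on `H`.
It extends to a unital completely positive Θ on `B(H)` that is a bimodule map over the crossed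
product (`exists_cp_extension`), so Θ intertwines `Ad_{u_g}` with `Ad_{u_{τ(g)}}` and fixes π(A^α).
Such a "twisted" Θ is far from unique, but φΘφ depends only on τ.

The reason is rigidity: φψφ = φ for every ψ in 𝔐 (`IsMinimalMap.apply_apply_apply`). Averages of the
maps φ(ψφ)^k lie in 𝔐 and below φ, so by minimality they bound φ in norm. At y - ψφ(y) they
telescope to O(1/n), so φ vanishes there. Now let S, T be twisted by τ and Θ by τ⁻¹. Untwisted
composites lie in 𝔐, so φΘφTφ = φ and φSφΘφTφ = φTφ, whence φSφ = φTφ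
(`IsMinimalMap.apply_twisted_unique`).

Uniqueness makes τ ↦ φΘφ multiplicative, so on the boundary these maps are invertible with
completely positive inverses. They are therefore complete isometries, and the Schwarz inequality for
a map and its inverse gives multiplicativity for the Choi–Effros product. Conversely, composing with
φ turns a unital complete isometry of the boundary into a completely positive map (`cpOfNormMapEq`).
Any competing action thus consists of twisted maps and agrees with this one. -/

/-- The cross terms of (z + it)^*(z + it) cancel, leaving z² + t². -/
theorem norm_add_smul_one_sq_le {z : M} (hz : IsSelfAdjoint z) (t : ℝ) :
    ‖z + ((t : ℂ) * Complex.I) • (1 : M)‖ ^ 2 ≤ ‖z‖ ^ 2 + t ^ 2 := by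
  have hst : star ((t : ℂ) * Complex.I) = -((t : ℂ) * Complex.I) := by simp
  have hmul : star (z + ((t : ℂ) * Complex.I) • (1 : M)) * (z + ((t : ℂ) * Complex.I) • (1 : M)) =
      z * z + ((t : ℂ) ^ 2) • (1 : M) := by
    have hsq : (t : ℂ) ^ 2 = -(((t : ℂ) * Complex.I) * ((t : ℂ) * Complex.I)) := by
      linear_combination ((t : ℂ) ^ 2) * Complex.I_sq
    rw [star_add, star_smul, star_one, hz.star_eq, hst, hsq]
    generalize (t : ℂ) * Complex.I = c
    rw [neg_smul, neg_smul, mul_smul, add_mul, mul_add, mul_add, neg_mul, neg_mul, smul_mul_assoc,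
      smul_mul_assoc, mul_smul_comm, one_mul, one_mul, mul_one]
    abel
  rw [sq, ← CStarRing.norm_star_mul_self, hmul]
  refine (norm_add_le _ _).trans (add_le_add ?_ ?_)
  · rw [sq]; exact norm_mul_le _ _
  · rw [norm_smul]
    have h3 : ‖(t : ℂ) ^ 2‖ = t ^ 2 := by simp
    rw [h3]
    rcases subsingleton_or_nontrivial M with h | h
    · rw [Subsingleton.elim (1 : M) 0]; simp; positivity
    · simp

/-- One of ±‖b‖ lies in the spectrum; s is its sign, and shifting by st moves that spectral point
away from 0. -/
theorem norm_add_le_norm_add_smul_one [Nontrivial N] {b : N} (hb : IsSelfAdjoint b) :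
    ∃ s : ℝ, s ^ 2 = 1 ∧ ∀ t : ℝ, 0 ≤ t → ‖b‖ + t ≤ ‖b + ((s * t : ℝ) : ℂ) • (1 : N)‖ := by
  have key : ∀ r t : ℝ, r ∈ spectrum ℝ b → |r + t| ≤ ‖b + ((t : ℝ) : ℂ) • (1 : N)‖ := by
    intro r t hr
    have h1 : r + t ∈ spectrum ℝ (algebraMap ℝ N t + b) :=
      spectrum.add_mem_add_iff.mpr hr
    have h2 := spectrum.norm_le_norm_of_mem h1
    rw [add_comm b]
    simpa [Algebra.algebraMap_eq_smul_one] using h2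
  rcases CStarAlgebra.norm_or_neg_norm_mem_spectrum hb with h | h
  · refine ⟨1, by norm_num, fun t ht => ?_⟩
    have := key _ t h
    rw [abs_of_nonneg (by positivity)] at this
    rwa [one_mul]
  · refine ⟨-1, by norm_num, fun t ht => ?_⟩
    have := key _ (-t) h
    rwa [abs_of_nonpos (by have := norm_nonneg b; linarith), neg_add, neg_neg, neg_neg,
      ← neg_one_mul] at this

/-- An imaginary part b ≠ 0 would give ‖w + ist‖ ≥ ‖b‖ + t for a suitable sign s, while ‖z + ist‖ ≤
√(‖z‖² + t²) exceeds t by an amount tending to 0. -/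
theorem isSelfAdjoint_of_forall_norm_add_le {z : M} {w : N} (hz : IsSelfAdjoint z)
    (h : ∀ c : ℂ, ‖w + c • (1 : N)‖ ≤ ‖z + c • (1 : M)‖) : IsSelfAdjoint w := by
  rcases subsingleton_or_nontrivial N with _ | _
  · exact Subsingleton.elim _ _
  suffices hb : (imaginaryPart w : N) = 0 by
    rw [← realPart_add_I_smul_imaginaryPart w, hb, smul_zero, add_zero]
    exact (realPart w).2
  set b : N := (imaginaryPart w : N) with hbdef
  obtain ⟨s, hs, hbs⟩ := norm_add_le_norm_add_smul_one (N := N) (b := b) (imaginaryPart w).2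
  have key : ∀ t : ℝ, 0 ≤ t → (‖b‖ + t) ^ 2 ≤ ‖z‖ ^ 2 + t ^ 2 := by
    intro t ht
    have h1 : (imaginaryPart (w + (((s * t : ℝ) : ℂ) * Complex.I) • (1 : N)) : N) =
        b + ((s * t : ℝ) : ℂ) • (1 : N) := by
      rw [map_add, AddSubgroup.coe_add, mul_comm, mul_smul, imaginaryPart_I_smul, hbdef]
      congr 1
      rw [realPart_apply_coe]
      simp only [star_smul, star_one, Complex.star_def, Complex.conj_ofReal]
      rw [← two_smul ℝ, smul_smul]
      norm_num
    have h2 := imaginaryPart.norm_le (w + (((s * t : ℝ) : ℂ) * Complex.I) • (1 : N))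
    have h3 : ‖b + ((s * t : ℝ) : ℂ) • (1 : N)‖ ≤
        ‖w + (((s * t : ℝ) : ℂ) * Complex.I) • (1 : N)‖ := by
      rw [← h1]; exact h2
    calc (‖b‖ + t) ^ 2 ≤ ‖z + (((s * t : ℝ) : ℂ) * Complex.I) • (1 : M)‖ ^ 2 := by
          gcongr
          exact (hbs t ht).trans (h3.trans (h _))
      _ ≤ ‖z‖ ^ 2 + (s * t) ^ 2 := norm_add_smul_one_sq_le hz _
      _ = ‖z‖ ^ 2 + t ^ 2 := by rw [mul_pow, hs, one_mul]
  by_contra hne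
  have hpos : 0 < ‖b‖ := norm_pos_iff.mpr hne
  -- This t makes the cross term 2‖b‖t equal to ‖z‖², leaving ‖b‖² ≤ 0.
  have h4 := key (‖z‖ ^ 2 / (2 * ‖b‖)) (by positivity)
  have h5 : 2 * ‖b‖ * (‖z‖ ^ 2 / (2 * ‖b‖)) = ‖z‖ ^ 2 := by field_simp
  nlinarith [pow_pos hpos 2]

theorem ofReal_neg_smul_one (r : ℝ) : ((-r : ℝ) : ℂ) • (1 : M) = -algebraMap ℝ M r := by
  rw [Algebra.algebraMap_eq_smul_one, Complex.ofReal_neg, neg_smul, Complex.coe_smul]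

variable [PartialOrder M] [StarOrderedRing M] [PartialOrder N] [StarOrderedRing N]

theorem exists_eq_star_mul_self {z : M} (hz : 0 ≤ z) : ∃ b, z = star b * b :=
  CStarAlgebra.nonneg_iff_eq_star_mul_self.mp hz

theorem star_mul_le_norm_sq_smul_one (z : M) : star z * z ≤ ((‖z‖ ^ 2 : ℝ) : ℂ) • (1 : M) := by
  rw [Complex.coe_smul, ← Algebra.algebraMap_eq_smul_one]
  exact CStarAlgebra.star_mul_le_algebraMap_norm_sq

theorem ofReal_smul_nonneg {z : M} (hz : 0 ≤ z) {r : ℝ} (hr : 0 ≤ r) : 0 ≤ (r : ℂ) • z := by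
  rw [Complex.coe_smul]
  exact smul_nonneg hr hz

theorem norm_le_of_nonneg_of_le_smul_one {z : M} (hz : 0 ≤ z) {r : ℝ} (hr : 0 ≤ r)
    (h : z ≤ (r : ℂ) • (1 : M)) : ‖z‖ ≤ r := by
  rw [Complex.coe_smul, ← Algebra.algebraMap_eq_smul_one] at h
  exact (CStarAlgebra.norm_le_iff_le_algebraMap z hr hz).mpr h

/-- The pointwise form of the positivity of unital contractions. -/
theorem nonneg_of_forall_norm_add_le {z : M} {w : N} (hz : 0 ≤ z)
    (h : ∀ c : ℂ, ‖w + c • (1 : N)‖ ≤ ‖z + c • (1 : M)‖) : 0 ≤ w := by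
  have hw : IsSelfAdjoint w := isSelfAdjoint_of_forall_norm_add_le (.of_nonneg hz) h
  have hz1 : z ≤ algebraMap ℝ M ‖z‖ := (IsSelfAdjoint.of_nonneg hz).le_algebraMap_norm_self
  have h1 : ‖algebraMap ℝ M ‖z‖ - z‖ ≤ ‖z‖ := by
    rw [CStarAlgebra.norm_le_iff_le_algebraMap _ (norm_nonneg _) (sub_nonneg.mpr hz1)]
    exact sub_le_self _ hz
  have h2 : ‖algebraMap ℝ N ‖z‖ - w‖ ≤ ‖z‖ := by
    -- With c = -‖z‖, w lies within ‖z‖ of ‖z‖·1, which puts its spectrum in [0, 2‖z‖].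
    have := h ((-‖z‖ : ℝ) : ℂ)
    rw [ofReal_neg_smul_one, ofReal_neg_smul_one, ← sub_eq_add_neg, ← sub_eq_add_neg, norm_sub_rev,
      norm_sub_rev z] at this
    exact this.trans h1
  have hsa : IsSelfAdjoint (algebraMap ℝ N ‖z‖ - w) :=
    (IsSelfAdjoint.algebraMap N (.all _)).sub hw
  have h3 : algebraMap ℝ N ‖z‖ - w ≤ algebraMap ℝ N ‖z‖ :=
    hsa.le_algebraMap_norm_self.trans (algebraMap_mono N h2)
  simpa using h3

end CStar

/-! ### Schwarz inequality and complete contractivity. -/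

section BlockMatrix

variable {M N : Type*} [CStarAlgebra M] [PartialOrder M] [StarOrderedRing M]
  [CStarAlgebra N] [PartialOrder N] [StarOrderedRing N] {n : Type*} [Fintype n] [DecidableEq n]

theorem nonneg_lowerRight {X : CStarMatrix (n ⊕ n) (n ⊕ n) M} (hX : 0 ≤ X) :
    0 ≤ (CStarMatrix.ofMatrix (Matrix.toBlocks₂₂ (CStarMatrix.ofMatrix.symm X)) :
      CStarMatrix n n M) := by
  obtain ⟨Z, rfl⟩ := exists_eq_star_mul_self hX
  have : (CStarMatrix.ofMatrix (Matrix.toBlocks₂₂ (CStarMatrix.ofMatrix.symm (star Z * Z))) :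
      CStarMatrix n n M) =
      star (CStarMatrix.ofMatrix (Matrix.toBlocks₁₂ (CStarMatrix.ofMatrix.symm Z)) :
        CStarMatrix n n M) *
        CStarMatrix.ofMatrix (Matrix.toBlocks₁₂ (CStarMatrix.ofMatrix.symm Z)) +
      star (CStarMatrix.ofMatrix (Matrix.toBlocks₂₂ (CStarMatrix.ofMatrix.symm Z)) :
        CStarMatrix n n M) *
        CStarMatrix.ofMatrix (Matrix.toBlocks₂₂ (CStarMatrix.ofMatrix.symm Z)) := by
    ext i j
    simp [CStarMatrix.mul_apply, CStarMatrix.star_apply, Matrix.toBlocks₁₂, Matrix.toBlocks₂₂]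
  rw [this]
  exact add_nonneg (star_mul_self_nonneg _) (star_mul_self_nonneg _)

/-- Z^*Z is the positive block matrix with rows (1, X) and (X^*, X^*X). After applying φ,
compressing by the column (-φ(X), 1) of `Y` yields φ(X^*X) - φ(X)^*φ(X) in the lower right corner.
-/
theorem star_map_mul_map_le (φ : M →CP N) (h1 : φ 1 = 1) (X : CStarMatrix n n M) :
    star (X.map φ) * X.map φ ≤ (star X * X).map φ := by
  set Z : CStarMatrix (n ⊕ n) (n ⊕ n) M := CStarMatrix.ofMatrix
    (Matrix.fromBlocks (1 : Matrix n n M) (CStarMatrix.ofMatrix.symm X) 0 0) with hZ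
  set Y : CStarMatrix (n ⊕ n) (n ⊕ n) N := CStarMatrix.ofMatrix
    (Matrix.fromBlocks 0 (-(CStarMatrix.ofMatrix.symm (X.map φ))) 0 (1 : Matrix n n N)) with hY
  have h2 := φ.map_cstarMatrix_nonneg _ (star_mul_self_nonneg Z)
  have h3 := nonneg_lowerRight (star_left_conjugate_nonneg h2 Y)
  rw [← sub_nonneg]
  convert h3 using 1
  set P : Matrix n n M := CStarMatrix.ofMatrix.symm X
  have hone : (1 : Matrix n n M).map φ = 1 := Matrix.map_one _ (map_zero φ) h1
  have hW : (star Z * Z).map φ = CStarMatrix.ofMatrix (Matrix.fromBlocks (1 : Matrix n n N)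
      (P.map φ) (Pᴴ.map φ) ((Pᴴ * P).map φ)) := by
    change CStarMatrix.ofMatrix (((Matrix.fromBlocks (1 : Matrix n n M) P 0 0)ᴴ *
      Matrix.fromBlocks (1 : Matrix n n M) P 0 0).map φ) = _
    rw [Matrix.fromBlocks_conjTranspose, Matrix.fromBlocks_multiply, Matrix.fromBlocks_map]
    simp [hone]
  have hP : Pᴴ.map φ = (P.map φ)ᴴ := by
    ext i j
    simp [map_star]
  rw [hW, hP]
  change CStarMatrix.ofMatrix ((Pᴴ * P).map φ - (P.map φ)ᴴ * P.map φ) =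
    CStarMatrix.ofMatrix (Matrix.toBlocks₂₂
      ((Matrix.fromBlocks 0 (-(P.map φ)) 0 (1 : Matrix n n N))ᴴ *
        Matrix.fromBlocks (1 : Matrix n n N) (P.map φ) (P.map φ)ᴴ ((Pᴴ * P).map φ) *
        Matrix.fromBlocks 0 (-(P.map φ)) 0 (1 : Matrix n n N)))
  rw [Matrix.fromBlocks_conjTranspose, Matrix.fromBlocks_multiply, Matrix.fromBlocks_multiply,
    Matrix.toBlocks_fromBlocks₂₂]
  congr 1
  simp
  abel

theorem nonneg_diag {X : CStarMatrix n n M} (hX : 0 ≤ X) (i : n) : 0 ≤ X i i := by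
  obtain ⟨Z, rfl⟩ := exists_eq_star_mul_self hX
  rw [CStarMatrix.mul_apply]
  exact Finset.sum_nonneg fun k _ => star_mul_self_nonneg (Z k i)

/-- Unital completely positive maps are completely contractive. -/
theorem norm_map_le (φ : M →CP N) (h1 : φ 1 = 1) (X : CStarMatrix n n M) : ‖X.map φ‖ ≤ ‖X‖ := by
  have h2 : star (X.map φ) * X.map φ ≤ ((‖X‖ ^ 2 : ℝ) : ℂ) • 1 := by
    refine (star_map_mul_map_le φ h1 X).trans ?_
    have h3 := φ.map_cstarMatrix_nonneg _ (sub_nonneg.mpr (star_mul_le_norm_sq_smul_one X))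
    rw [← sub_nonneg]
    convert h3 using 1
    ext i j
    rcases eq_or_ne i j with rfl | hij
    · simp [h1]
    · simp [hij]
  have h3 := norm_le_of_nonneg_of_le_smul_one (star_mul_self_nonneg (X.map φ)) (by positivity) h2
  rw [CStarRing.norm_star_mul_self, ← sq] at h3
  exact (sq_le_sq₀ (norm_nonneg _) (norm_nonneg _)).mp h3

/-- The Kadison-Schwarz inequality. -/
theorem star_apply_mul_apply_le (φ : M →CP N) (h1 : φ 1 = 1) (x : M) :
    star (φ x) * φ x ≤ φ (star x * x) := by
  have h := nonneg_diag (sub_nonneg.mpr (star_map_mul_map_le φ h1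
    (CStarMatrix.ofMatrix (fun _ _ : Fin 1 => x)))) 0
  rw [← sub_nonneg]
  simpa only [CStarMatrix.sub_apply, CStarMatrix.map_apply, CStarMatrix.mul_apply,
    CStarMatrix.star_apply, Finset.univ_unique, Finset.sum_singleton] using! h

theorem norm_apply_le (φ : M →CP N) (h1 : φ 1 = 1) (x : M) : ‖φ x‖ ≤ ‖x‖ := by
  have h2 : star (φ x) * φ x ≤ ((‖x‖ ^ 2 : ℝ) : ℂ) • 1 := by
    refine (star_apply_mul_apply_le φ h1 x).trans ?_
    have h3 := OrderHomClass.mono φ (star_mul_le_norm_sq_smul_one x)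
    rwa [map_smul, h1] at h3
  have h3 := norm_le_of_nonneg_of_le_smul_one (star_mul_self_nonneg (φ x)) (by positivity) h2
  rw [CStarRing.norm_star_mul_self, ← sq] at h3
  exact (sq_le_sq₀ (norm_nonneg _) (norm_nonneg _)).mp h3

end BlockMatrix

/-! ### Positivity of operator matrices tested on vectors; compressions. -/

theorem eq_zero_of_isSelfAdjoint_of_mul_self {A : Type*} [CStarAlgebra A] {N : A}
    (hN : IsSelfAdjoint N) (h : N * N = 0) : N = 0 := by
  have := CStarRing.norm_star_mul_self (x := N)
  rw [hN.star_eq, h, norm_zero] at this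
  simpa using this.symm

/-- An operator to compress with in order to test for positivity: for self-adjoint `X`, take `N` to
be the negative part of `X`. -/
theorem exists_mul_mul_eq_neg {A : Type*} [CStarAlgebra A] [PartialOrder A] [StarOrderedRing A]
    {X : A} (hX : IsSelfAdjoint X) :
    ∃ N Y : A, star N = N ∧ N * X * N = -(star Y * Y) ∧ (Y = 0 → 0 ≤ X) := by
  obtain ⟨Z, hZ⟩ := exists_eq_star_mul_self (CFC.negPart_nonneg X)
  have hN : IsSelfAdjoint X⁻ := .of_nonneg (CFC.negPart_nonneg X)
  -- With N = X⁻ = Z^*Z and Y = ZN, Y^*Y = N³ = -NXN. If Y = 0, then N⁴ = 0, and the C*-identity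
  -- used twice gives N = 0.
  have h3 : star (Z * X⁻) * (Z * X⁻) = X⁻ * X⁻ * X⁻ := by
    rw [star_mul, hN.star_eq, mul_assoc, ← mul_assoc (star Z), ← hZ, ← mul_assoc]
  refine ⟨X⁻, Z * X⁻, hN.star_eq, ?_, fun hY => ?_⟩
  · have h4 : X⁻ * X = -(X⁻ * X⁻) := by
      calc X⁻ * X = X⁻ * (X⁺ - X⁻) := by rw [CFC.posPart_sub_negPart X hX]
        _ = -(X⁻ * X⁻) := by rw [mul_sub, CFC.negPart_mul_posPart, zero_sub]
    rw [h3, h4, neg_mul]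
  · rw [hY, mul_zero] at h3
    have h4 : X⁻ * X⁻ = 0 := by
      refine eq_zero_of_isSelfAdjoint_of_mul_self (by rw [IsSelfAdjoint, star_mul, hN.star_eq]) ?_
      rw [← mul_assoc, ← h3, zero_mul]
    have h5 := eq_zero_of_isSelfAdjoint_of_mul_self hN h4
    rw [← CFC.posPart_sub_negPart X hX, h5, sub_zero]
    exact CFC.posPart_nonneg X

section Act

variable {H : Type*} [NormedAddCommGroup H] [InnerProductSpace ℂ H] {n : Type*} [Fintype n]

/-- The action of a matrix of operators on a column of vectors. -/
def opMulVec (X : CStarMatrix n n (H →L[ℂ] H)) (η : n → H) : n → H := fun i => ∑ j, X i j (η j)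

theorem opMulVec_mul (X Y : CStarMatrix n n (H →L[ℂ] H)) (η : n → H) :
    opMulVec (X * Y) η = opMulVec X (opMulVec Y η) := by
  ext i
  simp only [opMulVec, CStarMatrix.mul_apply, _root_.sum_apply,
    mul_apply_eq_comp, map_sum]
  exact Finset.sum_comm

theorem eq_zero_of_opMulVec_eq_zero {X : CStarMatrix n n (H →L[ℂ] H)}
    (h : ∀ η i, opMulVec X η i = 0) : X = 0 := by
  classical
  ext i j v
  have := h (Pi.single j v) i
  rw [opMulVec, Finset.sum_eq_single j] at this
  · simpa using this
  · intro k _ hk; simp [hk]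
  · simp

variable [CompleteSpace H]

theorem sum_inner_opMulVec_star (X : CStarMatrix n n (H →L[ℂ] H)) (ξ η : n → H) :
    ∑ i, inner ℂ (ξ i) (opMulVec (star X) η i) = ∑ i, inner ℂ (opMulVec X ξ i) (η i) := by
  simp only [opMulVec, CStarMatrix.star_apply, inner_sum, sum_inner,
    ContinuousLinearMap.star_eq_adjoint, ContinuousLinearMap.adjoint_inner_right]
  exact Finset.sum_comm

theorem sum_inner_opMulVec_star_mul_self (X : CStarMatrix n n (H →L[ℂ] H)) (η : n → H) :
    ∑ i, inner ℂ (η i) (opMulVec (star X * X) η i) = ((∑ i, ‖opMulVec X η i‖ ^ 2 : ℝ) : ℂ) := by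
  rw [opMulVec_mul, sum_inner_opMulVec_star]
  simp [inner_self_eq_norm_sq_to_K]

theorem re_sum_inner_opMulVec_nonneg {X : CStarMatrix n n (H →L[ℂ] H)} (hX : 0 ≤ X) (η : n → H) :
    0 ≤ (∑ i, inner ℂ (η i) (opMulVec X η i)).re := by
  classical
  obtain ⟨Y, rfl⟩ := exists_eq_star_mul_self hX
  rw [sum_inner_opMulVec_star_mul_self, Complex.ofReal_re]
  positivity

/-- With NXN = -Y^*Y, the quadratic form of X at Nη is -‖Yη‖². Nonnegativity forces Y = 0, so X has
no negative part. -/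
theorem nonneg_of_re_sum_inner_nonneg {X : CStarMatrix n n (H →L[ℂ] H)} (hX : IsSelfAdjoint X)
    (h : ∀ η : n → H, 0 ≤ (∑ i, inner ℂ (η i) (opMulVec X η i)).re) : 0 ≤ X := by
  classical
  obtain ⟨N, Y, hN, hY, h0⟩ := exists_mul_mul_eq_neg hX
  refine h0 (eq_zero_of_opMulVec_eq_zero fun η => ?_)
  have h1 : ∑ i, inner ℂ (η i) (opMulVec (N * X * N) η i) =
      ∑ i, inner ℂ (opMulVec N η i) (opMulVec X (opMulVec N η) i) := by
    rw [mul_assoc, opMulVec_mul, opMulVec_mul]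
    conv_lhs => rw [← hN]
    rw [sum_inner_opMulVec_star, hN]
  have h2 : ∑ i, inner ℂ (η i) (opMulVec (N * X * N) η i) =
      -((∑ i, ‖opMulVec Y η i‖ ^ 2 : ℝ) : ℂ) := by
    rw [hY, ← sum_inner_opMulVec_star_mul_self, ← Finset.sum_neg_distrib]
    refine Finset.sum_congr rfl fun i _ => ?_
    simp [opMulVec, inner_sum]
  have h3 := h (opMulVec N η)
  rw [← h1, h2, Complex.neg_re, Complex.ofReal_re] at h3
  have h4 : ∑ i, ‖opMulVec Y η i‖ ^ 2 = 0 :=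
    le_antisymm (by linarith) (by positivity)
  intro i
  have := (Finset.sum_eq_zero_iff_of_nonneg (fun i _ => by positivity)).mp h4 i (Finset.mem_univ i)
  simpa using this

end Act

section Compression

variable {B : Type*} [CStarAlgebra B] [PartialOrder B] [StarOrderedRing B]
  {H K : Type*} [NormedAddCommGroup H] [InnerProductSpace ℂ H] [CompleteSpace H]
  [NormedAddCommGroup K] [InnerProductSpace ℂ K] [CompleteSpace K]

open ContinuousLinearMap in
/-- The completely positive map `x ↦ V^* ρ(x) V` given by a representation `ρ` and an operator
`V`. -/
def compression (ρ : B →⋆ₐ[ℂ] (K →L[ℂ] K)) (V : H →L[ℂ] K) : B →CP (H →L[ℂ] H) where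
  toFun x := adjoint V ∘L ρ x ∘L V
  map_add' x y := by ext; simp
  map_smul' c x := by ext; simp
  map_cstarMatrix_nonneg' k M hM := by
    have hρ : 0 ≤ M.map ρ := CompletelyPositiveMapClass.map_cstarMatrix_nonneg' ρ k M hM
    refine nonneg_of_re_sum_inner_nonneg ?_ fun η => ?_
    · refine CStarMatrix.ext fun i j => ?_
      rw [CStarMatrix.star_apply, CStarMatrix.map_apply, CStarMatrix.map_apply,
        ← CStarMatrix.star_apply_of_isSelfAdjoint (.of_nonneg hM) (i := j) (j := i)]
      change star (adjoint V ∘L ρ (M j i) ∘L V) = adjoint V ∘L ρ (star (M j i)) ∘L V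
      rw [map_star, star_eq_adjoint, star_eq_adjoint, adjoint_comp, adjoint_comp, adjoint_adjoint]
      rfl
    · convert re_sum_inner_opMulVec_nonneg hρ (fun i => V (η i)) using 4 with i
      simp [opMulVec, adjoint_inner_right]

theorem compression_apply (ρ : B →⋆ₐ[ℂ] (K →L[ℂ] K)) (V : H →L[ℂ] K) (x : B) :
    compression ρ V x = ContinuousLinearMap.adjoint V ∘L ρ x ∘L V := rfl

end Compression

/-! ### Operations on completely positive maps. -/

section Operations

variable {A B C : Type*} [CStarAlgebra A] [PartialOrder A] [StarOrderedRing A]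
  [CStarAlgebra B] [PartialOrder B] [StarOrderedRing B]
  [CStarAlgebra C] [PartialOrder C] [StarOrderedRing C]

/-- Composition of completely positive maps. -/
def cpComp (ψ : B →CP C) (φ : A →CP B) : A →CP C where
  toLinearMap := ψ.toLinearMap ∘ₗ φ.toLinearMap
  map_cstarMatrix_nonneg' k M hM := ψ.map_cstarMatrix_nonneg' k _ (φ.map_cstarMatrix_nonneg' k M hM)

@[simp]
theorem cpComp_apply (ψ : B →CP C) (φ : A →CP B) (x : A) : cpComp ψ φ x = ψ (φ x) := rfl

/-- The identity as a completely positive map. -/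
def cpId : A →CP A where
  toLinearMap := .id
  map_cstarMatrix_nonneg' _ _ hM := hM

/-- The sum of two completely positive maps. -/
def cpAdd (ψ φ : A →CP B) : A →CP B where
  toLinearMap := ψ.toLinearMap + φ.toLinearMap
  map_cstarMatrix_nonneg' k M hM :=
    add_nonneg (ψ.map_cstarMatrix_nonneg' k M hM) (φ.map_cstarMatrix_nonneg' k M hM)

/-- A nonnegative multiple of a completely positive map. -/
def cpSMul (r : ℝ) (hr : 0 ≤ r) (φ : A →CP B) : A →CP B where
  toLinearMap := (r : ℂ) • φ.toLinearMap
  map_cstarMatrix_nonneg' k M hM :=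
    ofReal_smul_nonneg (φ.map_cstarMatrix_nonneg' k M hM) hr

@[simp]
theorem cpSMul_apply (r : ℝ) (hr : 0 ≤ r) (φ : A →CP B) (x : A) :
    cpSMul r hr φ x = (r : ℂ) • φ x := rfl

end Operations

/-! ### Arveson extension of representations, through GNS spaces. -/

section Isometry

variable {E H K ι : Type*} [AddCommGroup E] [Module ℂ E]
  [NormedAddCommGroup H] [InnerProductSpace ℂ H] [NormedAddCommGroup K] [InnerProductSpace ℂ K]

theorem inner_lsum_eq (s : ι → E →ₗ[ℂ] H) (t : ι → E →ₗ[ℂ] K)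
    (h : ∀ i j c d, inner ℂ (s i c) (s j d) = inner ℂ (t i c) (t j d)) (e : ι →₀ E) :
    inner ℂ (Finsupp.lsum ℂ s e) (Finsupp.lsum ℂ s e) =
      inner ℂ (Finsupp.lsum ℂ t e) (Finsupp.lsum ℂ t e) := by
  simp only [Finsupp.lsum_apply, Finsupp.sum, inner_sum, sum_inner, h]

variable [CompleteSpace H] [CompleteSpace K]

/-- Equal norms make S e ↦ T e well defined and isometric on a dense subspace, even if S is not
injective. -/
theorem exists_isometry_of_inner_eq (S : E →ₗ[ℂ] H) (T : E →ₗ[ℂ] K) (hS : DenseRange S)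
    (h : ∀ e, inner ℂ (S e) (S e) = inner ℂ (T e) (T e)) :
    ∃ W : H →L[ℂ] K, (∀ e, W (S e) = T e) ∧
      ContinuousLinearMap.adjoint W ∘L W = ContinuousLinearMap.id ℂ H := by
  have hn : ∀ e, ‖T e‖ = ‖S e‖ := fun e => by
    rw [norm_eq_sqrt_re_inner (𝕜 := ℂ), norm_eq_sqrt_re_inner (𝕜 := ℂ) (S e), h]
  have hW : ∀ e, T.extendOfNorm S (S e) = T e :=
    LinearMap.extendOfNorm_eq hS ⟨1, fun e => by rw [hn, one_mul]⟩
  refine ⟨T.extendOfNorm S, hW, ?_⟩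
  refine (ContinuousLinearMap.norm_map_iff_adjoint_comp_self _).mp ?_
  refine hS.induction ?_ (isClosed_eq (by fun_prop) (by fun_prop))
  rintro _ ⟨e, rfl⟩
  rw [hW, hn]

end Isometry

section Diagonal

variable {B : Type*} [CStarAlgebra B] {ι : Type*} {K : ι → Type*} [∀ i, NormedAddCommGroup (K i)]
  [∀ i, InnerProductSpace ℂ (K i)] [∀ i, CompleteSpace (K i)]

/-- The Hilbert sum of a family of representations. -/
def hilbertSumRep (ρ : ∀ i, B →⋆ₐ[ℂ] (K i →L[ℂ] K i)) : B →⋆ₐ[ℂ] (lp K 2 →L[ℂ] lp K 2) where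
  toFun x := lp.mapCLM 2 (fun i => ρ i x) (norm_nonneg x)
    (fun i => NonUnitalStarAlgHom.norm_apply_le (ρ i) x)
  map_one' := by ext v i; simp
  map_mul' x y := by ext v i; simp
  map_zero' := by ext v i; simp
  map_add' x y := by ext v i; simp
  commutes' r := by ext v i; simp [Algebra.algebraMap_eq_smul_one]
  map_star' x := by
    rw [ContinuousLinearMap.star_eq_adjoint, ContinuousLinearMap.eq_adjoint_iff]
    intro v w
    rw [lp.inner_eq_tsum, lp.inner_eq_tsum]
    refine tsum_congr fun i => ?_
    change inner ℂ (ρ i (star x) (v i)) (w i) = inner ℂ (v i) (ρ i x (w i))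
    rw [map_star, ContinuousLinearMap.star_eq_adjoint, ContinuousLinearMap.adjoint_inner_left]

theorem hilbertSumRep_single [DecidableEq ι] (ρ : ∀ i, B →⋆ₐ[ℂ] (K i →L[ℂ] K i)) (x : B) (i : ι)
    (v : K i) : hilbertSumRep ρ x (lp.single 2 i v) = lp.single 2 i (ρ i x v) := by
  ext j
  change ρ j x (lp.single 2 i v j) = lp.single 2 i (ρ i x v) j
  rcases eq_or_ne j i with rfl | h
  · simp
  · simp [h]

end Diagonal

section Extension

variable {B : Type*} [CStarAlgebra B]
  {H : Type*} [NormedAddCommGroup H] [InnerProductSpace ℂ H] [CompleteSpace H]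
  {C : StarSubalgebra ℂ B} (θ : C →⋆ₐ[ℂ] (H →L[ℂ] H))

/-- A maximal family of unit vectors generating pairwise orthogonal cyclic subspaces. -/
theorem exists_total_orthogonal_cyclic :
    ∃ S : Set H, (∀ ξ ∈ S, ‖ξ‖ = 1) ∧
      (∀ ξ ∈ S, ∀ η ∈ S, ξ ≠ η → ∀ c, inner ℂ ξ (θ c η) = 0) ∧
      ∀ ζ : H, (∀ ξ ∈ S, ∀ c, inner ℂ ζ (θ c ξ) = 0) → ζ = 0 := by
  obtain ⟨S, hS⟩ := zorn_subset {S : Set H | (∀ ξ ∈ S, ‖ξ‖ = 1) ∧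
      (∀ ξ ∈ S, ∀ η ∈ S, ξ ≠ η → ∀ c, inner ℂ ξ (θ c η) = 0)} (by
    intro s hs hchain
    refine ⟨⋃₀ s, ⟨?_, ?_⟩, fun t ht => Set.subset_sUnion_of_mem ht⟩
    · rintro ξ ⟨t, ht, hξ⟩
      exact (hs ht).1 ξ hξ
    · rintro ξ ⟨t, ht, hξ⟩ η ⟨t', ht', hη⟩ hne c
      rcases hchain.total ht ht' with h | h
      · exact (hs ht').2 ξ (h hξ) η hη hne c
      · exact (hs ht).2 ξ hξ η (h hη) hne c)
  refine ⟨S, hS.prop.1, hS.prop.2, fun ζ hζ => ?_⟩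
  by_contra hne
  set ζ' : H := ((‖ζ‖⁻¹ : ℝ) : ℂ) • ζ with hζ'
  have hn : ‖ζ'‖ = 1 := by
    rw [hζ', norm_smul, Complex.norm_real, norm_inv, norm_norm,
      inv_mul_cancel₀ (norm_ne_zero_iff.mpr hne)]
  have h0 : ∀ ξ ∈ S, ∀ c, inner ℂ ζ' (θ c ξ) = 0 := by
    intro ξ hξ c
    rw [hζ', inner_smul_left, hζ ξ hξ c, mul_zero]
  -- The family's condition concerns ordered pairs; the reverse order follows by passing to the
  -- adjoint of c.
  have h0' : ∀ ξ ∈ S, ∀ c, inner ℂ ξ (θ c ζ') = 0 := by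
    intro ξ hξ c
    have h1 := h0 ξ hξ (star c)
    rw [map_star, ContinuousLinearMap.star_eq_adjoint,
      ContinuousLinearMap.adjoint_inner_right] at h1
    exact inner_eq_zero_symm.mp h1
  have hins : insert ζ' S ∈ {S : Set H | (∀ ξ ∈ S, ‖ξ‖ = 1) ∧
      (∀ ξ ∈ S, ∀ η ∈ S, ξ ≠ η → ∀ c, inner ℂ ξ (θ c η) = 0)} := by
    refine ⟨?_, ?_⟩
    · rintro ξ (rfl | hξ)
      · exact hn
      · exact hS.prop.1 ξ hξ
    · rintro ξ (rfl | hξ) η (rfl | hη) hne' c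
      · exact absurd rfl hne'
      · exact h0 η hη c
      · exact h0' ξ hξ c
      · exact hS.prop.2 ξ hξ η hη hne' c
  have hmem : ζ' ∈ S := hS.le_of_ge hins (Set.subset_insert _ _) (Set.mem_insert _ _)
  have h2 := h0 ζ' hmem 1
  rw [map_one, one_apply_eq_self, inner_self_eq_zero] at h2
  rw [h2, norm_zero] at hn
  exact zero_ne_one hn

section Intertwiner

variable {ι : Type*} (ξ : ι → H) {K : ι → Type*} [∀ i, NormedAddCommGroup (K i)]
  [∀ i, InnerProductSpace ℂ (K i)] [∀ i, CompleteSpace (K i)]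
  (ρ : ∀ i, B →⋆ₐ[ℂ] (K i →L[ℂ] K i)) (q : ∀ i, B →ₗ[ℂ] K i)

/-- A representation of a subalgebra which is the sum of cyclic subrepresentations embeds into the
sum of representations of the whole algebra that contain the cyclic ones. -/
theorem exists_intertwining_isometry
    (hq : ∀ i (c d : C), inner ℂ (q i c) (q i d) = inner ℂ (ξ i) (θ (star c * d) (ξ i)))
    (hρ : ∀ i x y, ρ i x (q i y) = q i (x * y))
    (horth : ∀ i j, i ≠ j → ∀ c, inner ℂ (ξ i) (θ c (ξ j)) = 0)
    (htotal : ∀ ζ : H, (∀ i c, inner ℂ ζ (θ c (ξ i)) = 0) → ζ = 0) :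
    ∃ W : H →L[ℂ] lp K 2, ContinuousLinearMap.adjoint W ∘L W = ContinuousLinearMap.id ℂ H ∧
      ∀ c : C, W ∘L θ c = hilbertSumRep ρ c ∘L W := by
  classical
  -- W is to send θ(c)ξ_i to q_i(c) in the i-th summand; this is isometric because the two families
  -- have equal inner products.
  let s : ι → C →ₗ[ℂ] H := fun i =>
    (ContinuousLinearMap.apply ℂ H (ξ i)).toLinearMap ∘ₗ (θ : C →ₗ[ℂ] (H →L[ℂ] H))
  let t : ι → C →ₗ[ℂ] lp K 2 := fun i => lp.lsingle 2 i ∘ₗ q i ∘ₗ (C.subtype : C →ₗ[ℂ] B)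
  have hs : ∀ i c, s i c = θ c (ξ i) := fun _ _ => rfl
  have ht : ∀ i c, t i c = lp.single 2 i (q i c) := fun _ _ => rfl
  have hst : ∀ i j c d, inner ℂ (s i c) (s j d) = inner ℂ (t i c) (t j d) := by
    intro i j c d
    have hcyc : inner ℂ (θ c (ξ i)) (θ d (ξ j)) = inner ℂ (ξ i) (θ (star c * d) (ξ j)) := by
      rw [map_mul, map_star, ContinuousLinearMap.star_eq_adjoint, mul_apply_eq_comp,
        ContinuousLinearMap.adjoint_inner_right]
    rw [hs, hs, ht, ht, hcyc, lp.inner_single_left]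
    rcases eq_or_ne i j with rfl | hne
    · rw [lp.single_apply_self, hq]
    · rw [lp.single_apply_ne _ _ _ hne, inner_zero_right]
      exact horth i j hne _
  have hdense : DenseRange (Finsupp.lsum ℂ s) := by
    change Dense ((LinearMap.range (Finsupp.lsum ℂ s) : Submodule ℂ H) : Set H)
    rw [Submodule.dense_iff_topologicalClosure_eq_top, Submodule.topologicalClosure_eq_top_iff,
      Submodule.eq_bot_iff]
    intro ζ hζ
    refine htotal ζ fun i c => ?_
    refine (Submodule.mem_orthogonal' _ _).mp hζ _ ⟨Finsupp.single i c, ?_⟩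
    rw [Finsupp.lsum_single, hs]
  obtain ⟨W, hW, hWW⟩ := exists_isometry_of_inner_eq _ _ hdense (inner_lsum_eq s t hst)
  refine ⟨W, hWW, fun c => ?_⟩
  have hlin : (W ∘L θ c).toLinearMap ∘ₗ Finsupp.lsum ℂ s =
      (hilbertSumRep ρ c ∘L W).toLinearMap ∘ₗ Finsupp.lsum ℂ s := by
    refine Finsupp.lhom_ext fun i d => ?_
    change W (θ c (Finsupp.lsum ℂ s (Finsupp.single i d))) =
      hilbertSumRep ρ c (W (Finsupp.lsum ℂ s (Finsupp.single i d)))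
    have h1 : θ c (Finsupp.lsum ℂ s (Finsupp.single i d)) =
        Finsupp.lsum ℂ s (Finsupp.single i (c * d)) := by
      rw [Finsupp.lsum_single, Finsupp.lsum_single, hs, hs, map_mul, mul_apply_eq_comp]
    rw [h1, hW, hW, Finsupp.lsum_single, Finsupp.lsum_single, ht, ht, hilbertSumRep_single, hρ]
    rfl
  refine ContinuousLinearMap.ext fun v => ?_
  refine hdense.induction (P := fun v => (W ∘L θ c) v = (hilbertSumRep ρ c ∘L W) v) ?_
    (isClosed_eq (ContinuousLinearMap.continuous _) (ContinuousLinearMap.continuous _)) v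
  rintro _ ⟨e, rfl⟩
  exact LinearMap.congr_fun hlin e

end Intertwiner

variable [PartialOrder B] [StarOrderedRing B]

/-- The map of a C*-algebra into the GNS space of a positive functional. -/
def gnsVec (f : B →ₚ[ℂ] ℂ) : B →ₗ[ℂ] f.GNS :=
  UniformSpace.Completion.toComplL.toLinearMap ∘ₗ f.toPreGNS.toLinearMap

theorem inner_gnsVec (f : B →ₚ[ℂ] ℂ) (x y : B) :
    inner ℂ (gnsVec f x) (gnsVec f y) = f (star x * y) :=
  (UniformSpace.Completion.inner_coe _ _).trans (f.preGNS_inner_def _ _)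

theorem gnsStarAlgHom_gnsVec (f : B →ₚ[ℂ] ℂ) (x y : B) :
    f.gnsStarAlgHom x (gnsVec f y) = gnsVec f (x * y) :=
  f.gnsNonUnitalStarAlgHom_apply_coe

/-- Taking adjoints in Wθ(c^*) = ρ(c^*)W gives θ(c)W^* = W^*ρ(c), so θ(c) can be pulled out of
W^*ρ(·)W on both sides. -/
theorem compression_bimodule {K : Type*} [NormedAddCommGroup K] [InnerProductSpace ℂ K]
    [CompleteSpace K] (ρ : B →⋆ₐ[ℂ] (K →L[ℂ] K)) (W : H →L[ℂ] K)
    (hint : ∀ c : C, W ∘L θ c = ρ c ∘L W) :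
    (∀ (c : C) x, compression ρ W (c * x) = θ c * compression ρ W x) ∧
      ∀ (c : C) x, compression ρ W (x * c) = compression ρ W x * θ c := by
  have hint' : ∀ c : C, θ c ∘L ContinuousLinearMap.adjoint W =
      ContinuousLinearMap.adjoint W ∘L ρ c := by
    intro c
    have h1 := congrArg ContinuousLinearMap.adjoint (hint (star c))
    rwa [ContinuousLinearMap.adjoint_comp, ContinuousLinearMap.adjoint_comp,
      ← ContinuousLinearMap.star_eq_adjoint, ← ContinuousLinearMap.star_eq_adjoint (ρ _),
      ← map_star, ← map_star, star_star, ← StarMemClass.coe_star, star_star] at h1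
  refine ⟨fun c x => ?_, fun c x => ?_⟩
  · rw [compression_apply, compression_apply, map_mul]
    change ContinuousLinearMap.adjoint W ∘L ((ρ c ∘L ρ x) ∘L W) =
      θ c ∘L (ContinuousLinearMap.adjoint W ∘L ρ x ∘L W)
    rw [← ContinuousLinearMap.comp_assoc (θ c), hint']
    rfl
  · rw [compression_apply, compression_apply, map_mul]
    change ContinuousLinearMap.adjoint W ∘L ((ρ x ∘L ρ c) ∘L W) =
      (ContinuousLinearMap.adjoint W ∘L ρ x ∘L W) ∘L θ c
    rw [ContinuousLinearMap.comp_assoc, ← hint]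
    rfl

variable [IsClosed (C : Set B)]

/-- A vector state of a representation of a C*-subalgebra extends to the whole C*-algebra. -/
theorem exists_state_extension {ξ : H} (hξ : ‖ξ‖ = 1) :
    ∃ f : B →ₚ[ℂ] ℂ, ∀ c : C, f c = inner ℂ ξ (θ c ξ) := by
  let f₀ : C →ₗ[ℂ] ℂ := (innerSL ℂ ξ).toLinearMap ∘ₗ
    (ContinuousLinearMap.apply ℂ H ξ).toLinearMap ∘ₗ (θ : C →ₗ[ℂ] (H →L[ℂ] H))
  have hf₀ : ∀ c, f₀ c = inner ℂ ξ (θ c ξ) := fun c => rfl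
  have hb : ∀ c, ‖f₀ c‖ ≤ 1 * ‖c‖ := by
    intro c
    rw [hf₀]
    calc ‖inner ℂ ξ (θ c ξ)‖ ≤ ‖ξ‖ * (‖θ c‖ * ‖ξ‖) :=
          (norm_inner_le_norm _ _).trans (by gcongr; exact (θ c).le_opNorm ξ)
      _ ≤ 1 * ‖c‖ := by
          rw [hξ, mul_one]
          gcongr
          exact NonUnitalStarAlgHom.norm_apply_le θ c
  let p : Submodule ℂ B := C.toSubalgebra.toSubmodule
  -- Hahn–Banach keeps the norm at most 1, and g(1) = 1; a unital contractive functional is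
  -- positive.
  obtain ⟨g, hg, hgn⟩ := exists_extension_norm_eq (𝕜 := ℂ) p
    (LinearMap.mkContinuous (E := p) f₀ 1 hb)
  have hgC : ∀ c : C, g c = inner ℂ ξ (θ c ξ) := fun c => hg c
  have hg1 : g 1 = 1 := by
    have := hgC 1
    simpa [hξ, inner_self_eq_norm_sq_to_K] using this
  have hgb : ∀ x, ‖g x‖ ≤ ‖x‖ := by
    intro x
    have h1 : ‖g‖ ≤ 1 := by
      rw [hgn]; exact LinearMap.mkContinuous_norm_le _ zero_le_one hb
    simpa using g.le_of_opNorm_le h1 x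
  refine ⟨PositiveLinearMap.mk₀ g.toLinearMap fun x hx => ?_, hgC⟩
  refine nonneg_of_forall_norm_add_le (M := B) (N := ℂ) hx fun c => ?_
  have := hgb (x + c • 1)
  rwa [map_add, map_smul, hg1] at this

/-- Arveson's extension theorem for representations: a representation of a C*-subalgebra extends to
a unital completely positive map which is a bimodule map over the subalgebra. -/
theorem exists_cp_extension :
    ∃ Θ : B →CP (H →L[ℂ] H), Θ 1 = 1 ∧ (∀ (c : C) x, Θ (c * x) = θ c * Θ x) ∧
      ∀ (c : C) x, Θ (x * c) = Θ x * θ c := by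
  obtain ⟨S, hS1, hS2, hS3⟩ := exists_total_orthogonal_cyclic θ
  choose f hf using fun ξ : S => exists_state_extension θ (hS1 ξ ξ.2)
  -- On `C` the functional `f ξ` is the vector state of ξ, so its GNS space contains a copy of the
  -- cyclic subspace of ξ.
  obtain ⟨W, hWW, hint⟩ := exists_intertwining_isometry θ (fun ξ : S => (ξ : H))
    (fun ξ => (f ξ).gnsStarAlgHom) (fun ξ => gnsVec (f ξ))
    (fun ξ c d => by rw [inner_gnsVec, ← hf]; rfl)
    (fun ξ => gnsStarAlgHom_gnsVec (f ξ))
    (fun ξ η hne => hS2 ξ ξ.2 η η.2 fun h => hne (Subtype.ext h))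
    (fun ζ hζ => hS3 ζ fun ξ hξ => hζ ⟨ξ, hξ⟩)
  refine ⟨compression _ W, ?_, compression_bimodule θ _ W hint⟩
  rw [compression_apply, map_one]
  exact hWW

end Extension

/-! ### Twisted maps and rigidity of minimal elements. -/

namespace CovRep

variable {G A H : Type*} [Group G] [CStarAlgebra A] {α : G →* (A ≃⋆ₐ[ℂ] A)}
  [NormedAddCommGroup H] [InnerProductSpace ℂ H] [CompleteSpace H] (R : CovRep α H)

/-- A unital completely positive map on `B(H)` that intertwines `Ad_{u_g}` with `Ad_{u_{τ(g)}}` and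
is the identity on `π(A^α)`. -/
def IsTwisted (τ : MulAut G) (S : (H →L[ℂ] H) →CP (H →L[ℂ] H)) : Prop :=
  S 1 = 1 ∧ (∀ g x, S (R.ad g x) = R.ad (τ g) (S x)) ∧
    ∀ a ∈ fixedAlgebra α, S (R.π a) = R.π a

variable {R} in
theorem IsTwisted.comp {σ τ : MulAut G} {S T : (H →L[ℂ] H) →CP (H →L[ℂ] H)}
    (hS : R.IsTwisted σ S) (hT : R.IsTwisted τ T) : R.IsTwisted (σ * τ) (cpComp S T) := by
  refine ⟨?_, fun g x => ?_, fun a ha => ?_⟩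
  · rw [cpComp_apply, hT.1, hS.1]
  · rw [cpComp_apply, hT.2.1, hS.2.1]
    rfl
  · rw [cpComp_apply, hT.2.2 a ha, hS.2.2 a ha]

theorem isTwisted_one_iff {S : (H →L[ℂ] H) →CP (H →L[ℂ] H)} :
    R.IsTwisted 1 S ↔ S ∈ R.mapSet := Iff.rfl

variable {R} in
theorem IsTwisted.comp_mem_mapSet {σ τ : MulAut G} {S T : (H →L[ℂ] H) →CP (H →L[ℂ] H)}
    (hS : R.IsTwisted σ S) (hT : R.IsTwisted τ T) (h : σ * τ = 1) : cpComp S T ∈ R.mapSet :=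
  R.isTwisted_one_iff.mp (h ▸ hS.comp hT)

theorem ad_add (g : G) (x y : H →L[ℂ] H) : R.ad g (x + y) = R.ad g x + R.ad g y := by
  simp only [ad, mul_add, add_mul]

theorem ad_smul (g : G) (c : ℂ) (x : H →L[ℂ] H) : R.ad g (c • x) = c • R.ad g x := by
  simp only [ad, mul_smul_comm, smul_mul_assoc]

theorem ad_mul (g h : G) (x : H →L[ℂ] H) : R.ad (g * h) x = R.ad g (R.ad h x) := by
  simp only [ad, map_mul, Submonoid.coe_mul, star_mul, mul_assoc]

section Averages

variable (φ ψ : (H →L[ℂ] H) →CP (H →L[ℂ] H))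

/-- The iterates `φ ∘ (ψ ∘ φ)^k`. -/
def iterateMap : ℕ → ((H →L[ℂ] H) →CP (H →L[ℂ] H))
  | 0 => φ
  | k + 1 => cpComp (iterateMap k) (cpComp ψ φ)

/-- The sum of the first `n + 1` iterates. -/
def iterateSum : ℕ → ((H →L[ℂ] H) →CP (H →L[ℂ] H))
  | 0 => φ
  | n + 1 => cpAdd (iterateSum n) (iterateMap φ ψ (n + 1))

variable {φ ψ}

theorem iterateSum_succ_apply (n : ℕ) (x : H →L[ℂ] H) :
    iterateSum φ ψ (n + 1) x = iterateSum φ ψ n x + iterateMap φ ψ (n + 1) x := rfl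

theorem iterateMap_succ_apply (n : ℕ) (x : H →L[ℂ] H) :
    iterateMap φ ψ (n + 1) x = iterateMap φ ψ n (ψ (φ x)) := rfl

/-- Telescoping: the k-th iterate at ψ(φ(y)) is the (k+1)-st iterate at y. -/
theorem iterateSum_sub (n : ℕ) (y : H →L[ℂ] H) :
    iterateSum φ ψ n (y - ψ (φ y)) = φ y - iterateMap φ ψ (n + 1) y := by
  induction n with
  | zero => exact map_sub φ _ _
  | succ n ih =>
    rw [iterateSum_succ_apply, ih, map_sub, iterateMap_succ_apply (n + 1)]
    abel

variable {R}

theorem iterateMap_mem_mapSet (hφ : φ ∈ R.mapSet) (hψ : ψ ∈ R.mapSet) (k : ℕ) :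
    iterateMap φ ψ k ∈ R.mapSet := by
  induction k with
  | zero => exact hφ
  | succ k ih =>
    exact IsTwisted.comp_mem_mapSet (σ := 1) (τ := 1) ih
      (IsTwisted.comp_mem_mapSet (σ := 1) (τ := 1) hψ hφ (mul_one 1)) (mul_one 1)

theorem norm_iterateMap_le (hφ : φ ∈ R.mapSet) (hψ : ψ ∈ R.mapSet) (k : ℕ) (x : H →L[ℂ] H) :
    ‖iterateMap φ ψ k x‖ ≤ ‖φ x‖ := by
  induction k generalizing x with
  | zero => exact le_rfl
  | succ k ih =>
    exact (ih _).trans ((norm_apply_le φ hφ.1 _).trans (norm_apply_le ψ hψ.1 _))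

theorem norm_iterateSum_le (hφ : φ ∈ R.mapSet) (hψ : ψ ∈ R.mapSet) (n : ℕ) (x : H →L[ℂ] H) :
    ‖iterateSum φ ψ n x‖ ≤ (n + 1) * ‖φ x‖ := by
  induction n with
  | zero => simp [iterateSum]
  | succ n ih =>
    rw [iterateSum_succ_apply]
    refine (norm_add_le _ _).trans ((add_le_add ih (norm_iterateMap_le hφ hψ _ x)).trans ?_)
    push_cast
    linarith

/-- The averages of the iterates. -/
def iterateAverage (φ ψ : (H →L[ℂ] H) →CP (H →L[ℂ] H)) (n : ℕ) :
    (H →L[ℂ] H) →CP (H →L[ℂ] H) :=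
  cpSMul ((n : ℝ) + 1)⁻¹ (by positivity) (iterateSum φ ψ n)

theorem norm_iterateAverage (n : ℕ) (x : H →L[ℂ] H) :
    ‖iterateAverage φ ψ n x‖ = ((n : ℝ) + 1)⁻¹ * ‖iterateSum φ ψ n x‖ := by
  rw [iterateAverage, cpSMul_apply, norm_smul, Complex.norm_real, Real.norm_of_nonneg]
  positivity

/-- 𝔐 is closed under composition and convex. -/
theorem iterateAverage_mem_mapSet (hφ : φ ∈ R.mapSet) (hψ : ψ ∈ R.mapSet) (n : ℕ) :
    iterateAverage φ ψ n ∈ R.mapSet := by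
  have hfix : ∀ x, (∀ k, iterateMap φ ψ k x = x) →
      iterateSum φ ψ n x = ((n : ℂ) + 1) • x := by
    intro x hx
    induction n with
    | zero =>
      have h0 := hx 0
      rw [iterateMap] at h0
      simpa [iterateSum] using h0
    | succ n ih =>
      rw [iterateSum_succ_apply, ih, hx]
      push_cast
      module
  have havg : ∀ x, (∀ k, iterateMap φ ψ k x = x) → iterateAverage φ ψ n x = x := by
    intro x hx
    rw [iterateAverage, cpSMul_apply, hfix x hx, smul_smul]
    have h1 : ((n : ℂ) + 1) ≠ 0 := Nat.cast_add_one_ne_zero n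
    push_cast
    rw [inv_mul_cancel₀ h1, one_smul]
  refine ⟨havg 1 fun k => (iterateMap_mem_mapSet hφ hψ k).1, fun g x => ?_,
    fun a ha => havg _ fun k => (iterateMap_mem_mapSet hφ hψ k).2.2 a ha⟩
  have hsum : iterateSum φ ψ n (R.ad g x) = R.ad g (iterateSum φ ψ n x) := by
    clear hfix havg
    induction n with
    | zero => exact hφ.2.1 g x
    | succ n ih =>
      rw [iterateSum_succ_apply, iterateSum_succ_apply, ad_add, ih,
        (iterateMap_mem_mapSet hφ hψ _).2.1]
  rw [iterateAverage, cpSMul_apply, cpSMul_apply, hsum, ad_smul]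

/-- Rigidity of minimal maps. -/
theorem IsMinimalMap.apply_apply_apply (hφ : R.IsMinimalMap φ) (hψ : ψ ∈ R.mapSet)
    (y : H →L[ℂ] H) : φ (ψ (φ y)) = φ y := by
  -- The n-th average is below φ, so minimality bounds φ by it in norm; at y - ψ(φ(y)) only two
  -- terms survive the telescoping.
  have hbound : ∀ n : ℕ, ‖φ (y - ψ (φ y))‖ ≤ ((n : ℝ) + 1)⁻¹ * (2 * ‖φ y‖) := by
    intro n
    refine (hφ.2 _ (iterateAverage_mem_mapSet hφ.1 hψ n) (fun x => ?_) _).trans ?_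
    · rw [norm_iterateAverage, inv_mul_le_iff₀ (by positivity)]
      exact norm_iterateSum_le hφ.1 hψ n x
    · rw [norm_iterateAverage, iterateSum_sub]
      gcongr
      rw [two_mul]
      exact (norm_sub_le _ _).trans (by gcongr; exact norm_iterateMap_le hφ.1 hψ _ y)
  have hlim : Filter.Tendsto (fun n : ℕ => ((n : ℝ) + 1)⁻¹ * (2 * ‖φ y‖)) Filter.atTop
      (nhds 0) := by
    have := (tendsto_one_div_add_atTop_nhds_zero_nat (𝕜 := ℝ)).mul_const (2 * ‖φ y‖)
    simpa using this
  have h0 : φ (y - ψ (φ y)) = 0 := norm_le_zero_iff.mp (ge_of_tendsto' hlim hbound)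
  rw [map_sub, sub_eq_zero] at h0
  exact h0.symm

theorem one_mem_mapSet : (cpId : (H →L[ℂ] H) →CP (H →L[ℂ] H)) ∈ R.mapSet :=
  ⟨rfl, fun _ _ => rfl, fun _ _ => rfl⟩

theorem IsMinimalMap.apply_apply (hφ : R.IsMinimalMap φ) (y : H →L[ℂ] H) : φ (φ y) = φ y :=
  hφ.apply_apply_apply one_mem_mapSet y

theorem IsMinimalMap.apply_of_mem (hφ : R.IsMinimalMap φ) {y : H →L[ℂ] H} (hy : y ∈ boundary φ) :
    φ y = y := by
  obtain ⟨x, rfl⟩ := hy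
  exact hφ.apply_apply x

end Averages

theorem isClosed_crossedProduct : IsClosed (R.crossedProduct : Set (H →L[ℂ] H)) :=
  StarSubalgebra.isClosed_topologicalClosure _

/-- The unitaries u_g and the operators π(a) lie in the crossed product, over which the Arveson
extension of θ is a bimodule map. This gives the intertwining relation, and evaluation at 1 gives
the values on π(A^α). -/
theorem exists_isTwisted {τ : MulAut G} (hτ : τ ∈ R.autGroup) : ∃ Θ, R.IsTwisted τ Θ := by
  obtain ⟨θ, hθ, hθ'⟩ := hτ
  have := R.isClosed_crossedProduct
  obtain ⟨Θ, h1, hl, hr⟩ := exists_cp_extension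
    (R.crossedProduct.subtype.comp (θ : R.crossedProduct →⋆ₐ[ℂ] R.crossedProduct))
  refine ⟨Θ, h1, fun g x => ?_, fun a ha => ?_⟩
  · have hu := hl ⟨R.u g, R.u_mem g⟩
    have hu' := hr (star ⟨R.u g, R.u_mem g⟩)
    have hθu : (θ ⟨R.u g, R.u_mem g⟩ : H →L[ℂ] H) = R.u (τ g) := congrArg Subtype.val (hθ g)
    change Θ ((R.u g : H →L[ℂ] H) * x * star (R.u g : H →L[ℂ] H)) = _
    refine (hu' _).trans ?_
    rw [map_star]
    change Θ ((R.u g : H →L[ℂ] H) * x) * star (θ ⟨R.u g, R.u_mem g⟩ : H →L[ℂ] H) = _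
    rw [hθu]
    refine congrArg (· * _) ((hu x).trans ?_)
    change (θ ⟨R.u g, R.u_mem g⟩ : H →L[ℂ] H) * Θ x = _
    rw [hθu]
  · have := hl ⟨R.π a, R.pi_mem a⟩ 1
    rw [mul_one, h1, mul_one] at this
    exact this.trans (congrArg Subtype.val (hθ' a ha))

section Extension

variable {R} {φ : (H →L[ℂ] H) →CP (H →L[ℂ] H)}

/-- For Θ twisted by τ⁻¹, both ΘφT and SφΘ lie in 𝔐. Rigidity gives φΘφTφ = φ and φSφΘφTφ = φTφ;
substitute the first into the second. -/
theorem IsMinimalMap.apply_twisted_unique (hφ : R.IsMinimalMap φ) {τ : MulAut G}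
    (hτ : τ ∈ R.autGroup)
    {S T : (H →L[ℂ] H) →CP (H →L[ℂ] H)} (hS : R.IsTwisted τ S) (hT : R.IsTwisted τ T)
    (x : H →L[ℂ] H) : φ (S (φ x)) = φ (T (φ x)) := by
  obtain ⟨Θ, hΘ⟩ := R.exists_isTwisted (inv_mem hτ)
  have hφ1 : R.IsTwisted 1 φ := hφ.1
  have h1 := hφ.apply_apply_apply
    (((hΘ.comp hφ1).comp_mem_mapSet hT (by simp)) : cpComp (cpComp Θ φ) T ∈ R.mapSet) x
  have h2 := hφ.apply_apply_apply
    (((hS.comp hφ1).comp_mem_mapSet hΘ (by simp)) : cpComp (cpComp S φ) Θ ∈ R.mapSet)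
    (T (φ x))
  simp only [cpComp_apply] at h1 h2
  rw [h1] at h2
  exact h2

end Extension

end CovRep

/-! ### Multiplicativity for the Choi–Effros product. -/

section ChoiEffros

variable {B : Type*} [CStarAlgebra B] [PartialOrder B] [StarOrderedRing B]

/-- Mutually inverse unital completely positive maps on the image of `φ` preserve the Choi-Effros
products `x^* · x`. -/
theorem apply_star_mul_self_eq {φ S T : B →CP B} (hS1 : S 1 = 1) (hT1 : T 1 = 1)
    (hφS : ∀ x, φ (S x) = S x) (hφT : ∀ x, φ (T x) = T x)
    (hST : ∀ x, S (T x) = φ x) (hTS : ∀ x, T (S x) = φ x)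
    (x : B) (hx : φ x = x) : S (star x * x) = φ (star (S x) * S x) := by
  have hSφ : ∀ y, S (φ y) = S y := fun y => by rw [← hTS, hST, hφS]
  have key : ∀ {S : B →CP B}, S 1 = 1 → (∀ x, φ (S x) = S x) →
      ∀ x, φ (star (S x) * S x) ≤ S (star x * x) := by
    intro S h1 h2 x
    rw [← h2 (star x * x)]
    exact OrderHomClass.mono φ (star_apply_mul_apply_le S h1 x)
  refine le_antisymm ?_ (key hS1 hφS x)
  -- Applying S to the Schwarz inequality for T at S x yields the reverse inequality, since TS and
  -- ST equal φ and Sφ = S.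
  have h3 := OrderHomClass.mono S (key hT1 hφT (S x))
  rw [hTS, hx, hSφ, hST] at h3
  exact h3

/-- Polarization of `apply_star_mul_self_eq`. -/
theorem apply_star_mul_eq {φ S T : B →CP B} (hS1 : S 1 = 1) (hT1 : T 1 = 1)
    (hφS : ∀ x, φ (S x) = S x) (hφT : ∀ x, φ (T x) = T x)
    (hST : ∀ x, S (T x) = φ x) (hTS : ∀ x, T (S x) = φ x)
    (x y : B) (hx : φ x = x) (hy : φ y = y) : S (star x * y) = φ (star (S x) * S y) := by
  have h := apply_star_mul_self_eq hS1 hT1 hφS hφT hST hTS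
  have e1 := h x hx
  have e2 := h y hy
  have e3 := h (x + y) (by rw [map_add, hx, hy])
  have e4 := h (x + Complex.I • y) (by rw [map_add, map_smul, hx, hy])
  simp only [map_add, map_smul, star_add, star_smul, add_mul, mul_add, smul_mul_assoc,
    mul_smul_comm, e1, e2] at e3 e4
  have hI : star Complex.I = -Complex.I := Complex.conj_I
  rw [hI] at e4
  set a := S (star x * y)
  set b := S (star y * x)
  set a' := φ (star (S x) * S y)
  set b' := φ (star (S y) * S x)
  have e5 : a + b = a' + b' := by
    linear_combination (norm := module) e3
  have e6 : Complex.I • a - Complex.I • b = Complex.I • a' - Complex.I • b' := by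
    linear_combination (norm := module) e4
  have e7 : a - b = a' - b' := by
    rw [← smul_sub, ← smul_sub] at e6
    exact smul_right_injective B Complex.I_ne_zero e6
  linear_combination (norm := module) (1 / 2 : ℂ) • e5 + (1 / 2 : ℂ) • e7

end ChoiEffros

/-! ### From norms of amplifications to complete positivity. -/

section CompleteIsometry

variable {M N N' : Type*} [CStarAlgebra M] [CStarAlgebra N] [CStarAlgebra N']

theorem map_add_smul_one {n : Type*} [DecidableEq n] (X : CStarMatrix n n M)
    (c : ℂ) (F : M →ₗ[ℂ] N) (hF : F 1 = 1) : (X + c • 1).map F = X.map F + c • 1 := by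
  refine CStarMatrix.ext fun i j => ?_
  rcases eq_or_ne i j with rfl | hij
  · simp [hF]
  · simp [hij]

variable [PartialOrder M] [StarOrderedRing M] [PartialOrder N] [StarOrderedRing N]
  [PartialOrder N'] [StarOrderedRing N']

/-- A unital linear map whose amplifications have the same norms as those of a unital completely
positive map is completely positive. -/
def cpOfNormMapEq (φ : M →CP N) (h1 : φ 1 = 1) (S : M →ₗ[ℂ] N') (hS1 : S 1 = 1)
    (h : ∀ (k : ℕ) (X : CStarMatrix (Fin k) (Fin k) M), ‖X.map S‖ = ‖X.map φ‖) : M →CP N' where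
  toLinearMap := S
  map_cstarMatrix_nonneg' k X hX := by
    refine nonneg_of_forall_norm_add_le (φ.map_cstarMatrix_nonneg' k X hX) fun c => ?_
    rw [← map_add_smul_one X c S hS1, ← map_add_smul_one X c φ.toLinearMap h1]
    exact (h k _).le

end CompleteIsometry

/-! ### The action on the boundary and its uniqueness. -/

namespace CovRep

variable {G A H : Type*} [Group G] [CStarAlgebra A] {α : G →* (A ≃⋆ₐ[ℂ] A)}
  [NormedAddCommGroup H] [InnerProductSpace ℂ H] [CompleteSpace H] {R : CovRep α H}

/-- `Ad_{u_g}` as a completely positive map. -/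
def adCP (R : CovRep α H) (g : G) : (H →L[ℂ] H) →CP (H →L[ℂ] H) :=
  compression (StarAlgHom.id ℂ _) (star (R.u g : H →L[ℂ] H))

theorem adCP_apply (g : G) (x : H →L[ℂ] H) : R.adCP g x = R.ad g x := by
  rw [adCP, compression_apply, ContinuousLinearMap.star_eq_adjoint,
    ContinuousLinearMap.adjoint_adjoint, ← ContinuousLinearMap.star_eq_adjoint, ad, mul_assoc]
  rfl

theorem isTwisted_adCP (g : G) : R.IsTwisted (MulAut.conj g) (R.adCP g) := by
  refine ⟨?_, fun h x => ?_, fun a ha => ?_⟩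
  · rw [adCP_apply, ad, mul_one]
    exact Unitary.coe_mul_star_self _
  · rw [adCP_apply, adCP_apply, ← ad_mul, ← ad_mul, MulAut.conj_apply, inv_mul_cancel_right]
  · rw [adCP_apply]
    change (R.u g : H →L[ℂ] H) * R.π a * star (R.u g : H →L[ℂ] H) = R.π a
    rw [R.covariant, ha g]

/-- The completely positive map on `B(H)` which restricts on the boundary to the extension of an
automorphism of `G`. -/
def twist (φ : (H →L[ℂ] H) →CP (H →L[ℂ] H)) (τ : R.autGroup) : (H →L[ℂ] H) →CP (H →L[ℂ] H) :=
  cpComp φ (cpComp (R.exists_isTwisted τ.2).choose φ)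

variable {φ : (H →L[ℂ] H) →CP (H →L[ℂ] H)} (hφ : R.IsMinimalMap φ)

theorem isTwisted_twist (hφ : R.IsMinimalMap φ) (τ : R.autGroup) :
    R.IsTwisted τ.1 (twist φ τ) := by
  have hφ1 : R.IsTwisted 1 φ := hφ.1
  have := hφ1.comp ((R.exists_isTwisted τ.2).choose_spec.comp hφ1)
  rwa [one_mul, mul_one] at this

theorem apply_twist (hφ : R.IsMinimalMap φ) (τ : R.autGroup) (x : H →L[ℂ] H) :
    φ (twist φ τ x) = twist φ τ x :=
  hφ.apply_apply _

/-- The chosen extension does not matter: any map twisted by τ computes the same compression. The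
group law, the value on inner automorphisms and the uniqueness of the action all come from inserting
a suitable S. -/
theorem eq_twist (hφ : R.IsMinimalMap φ) (τ : R.autGroup)
    {S : (H →L[ℂ] H) →CP (H →L[ℂ] H)} (hS : R.IsTwisted τ.1 S) (x : H →L[ℂ] H) :
    φ (S (φ x)) = twist φ τ x :=
  hφ.apply_twisted_unique τ.2 hS (R.exists_isTwisted τ.2).choose_spec x

theorem twist_apply (hφ : R.IsMinimalMap φ) (τ : R.autGroup) (x : H →L[ℂ] H) :
    twist φ τ (φ x) = twist φ τ x := by
  rw [← eq_twist hφ τ (isTwisted_twist hφ τ), hφ.apply_apply,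
    eq_twist hφ τ (isTwisted_twist hφ τ)]

theorem twist_mul (hφ : R.IsMinimalMap φ) (σ τ : R.autGroup) (x : H →L[ℂ] H) :
    twist φ (σ * τ) x = twist φ σ (twist φ τ x) := by
  rw [← eq_twist hφ (σ * τ) ((isTwisted_twist hφ σ).comp (isTwisted_twist hφ τ)), cpComp_apply,
    apply_twist hφ, twist_apply hφ]

theorem twist_one (hφ : R.IsMinimalMap φ) (x : H →L[ℂ] H) :
    twist φ (1 : R.autGroup) x = φ x := by
  rw [← eq_twist hφ 1 (show R.IsTwisted 1 φ from hφ.1), hφ.apply_apply, hφ.apply_apply]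

theorem twist_inv_twist (hφ : R.IsMinimalMap φ) (τ : R.autGroup) (x : H →L[ℂ] H) :
    twist φ τ⁻¹ (twist φ τ x) = φ x := by
  rw [← twist_mul hφ, inv_mul_cancel, twist_one hφ]

theorem twist_twist_inv (hφ : R.IsMinimalMap φ) (τ : R.autGroup) (x : H →L[ℂ] H) :
    twist φ τ (twist φ τ⁻¹ x) = φ x := by
  rw [← twist_mul hφ, mul_inv_cancel, twist_one hφ]

theorem twist_star_mul (hφ : R.IsMinimalMap φ) (τ : R.autGroup) {x y : H →L[ℂ] H}
    (hx : x ∈ boundary φ) (hy : y ∈ boundary φ) :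
    twist φ τ (star x * y) = φ (star (twist φ τ x) * twist φ τ y) :=
  apply_star_mul_eq (isTwisted_twist hφ τ).1 (isTwisted_twist hφ τ⁻¹).1 (apply_twist hφ τ)
    (apply_twist hφ τ⁻¹) (twist_twist_inv hφ τ) (twist_inv_twist hφ τ) x y
    (hφ.apply_of_mem hx) (hφ.apply_of_mem hy)

theorem twist_mem_boundary (τ : R.autGroup) (x : H →L[ℂ] H) : twist φ τ x ∈ boundary φ :=
  apply_mem_boundary φ _

/-- The restriction of `twist φ τ` to the boundary. -/
def boundaryLinearMap (φ : (H →L[ℂ] H) →CP (H →L[ℂ] H)) (τ : R.autGroup) :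
    boundary φ →ₗ[ℂ] boundary φ :=
  ((twist φ τ).toLinearMap ∘ₗ (boundary φ).subtype).codRestrict (boundary φ)
    fun x => twist_mem_boundary τ x.1

/-- The bijective linear map of the boundary induced by an automorphism of `G`. -/
def boundaryLinearEquiv (hφ : R.IsMinimalMap φ) (τ : R.autGroup) :
    boundary φ ≃ₗ[ℂ] boundary φ :=
  LinearEquiv.ofLinearMap (boundaryLinearMap φ τ) (boundaryLinearMap φ τ⁻¹)
    (LinearMap.ext fun x => Subtype.ext ((twist_twist_inv hφ τ x).trans (hφ.apply_of_mem x.2)))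
    (LinearMap.ext fun x => Subtype.ext ((twist_inv_twist hφ τ x).trans (hφ.apply_of_mem x.2)))

theorem coe_boundaryLinearEquiv (τ : R.autGroup) (x : boundary φ) :
    (boundaryLinearEquiv hφ τ x : H →L[ℂ] H) = twist φ τ x := rfl

/-- The map and its inverse are restrictions of unital completely positive maps, so both are
complete contractions. -/
theorem boundaryLinearEquiv_mem_uciAut (τ : R.autGroup) :
    boundaryLinearEquiv hφ τ ∈ uciAut (boundary φ) := by
  refine ⟨fun v hv => ?_, fun n M => le_antisymm ?_ ?_⟩
  · rw [coe_boundaryLinearEquiv, hv, (isTwisted_twist hφ τ).1]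
  · exact norm_map_le (twist φ τ) (isTwisted_twist hφ τ).1
      (CStarMatrix.ofMatrix (M.map fun v => (v : H →L[ℂ] H)))
  · have h := norm_map_le (twist φ τ⁻¹) (isTwisted_twist hφ τ⁻¹).1
      (CStarMatrix.ofMatrix (M.map fun v => (boundaryLinearEquiv hφ τ v : H →L[ℂ] H)))
    refine le_of_eq_of_le (congrArg norm ?_) h
    refine CStarMatrix.ext fun i j => ?_
    exact ((twist_inv_twist hφ τ _).trans (hφ.apply_of_mem (M i j).2)).symm

/-- The action of `Aut_{π,u}(G)` on the boundary. -/
def boundaryAction : R.autGroup →* uciAut (boundary φ) where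
  toFun τ := ⟨boundaryLinearEquiv hφ τ, boundaryLinearEquiv_mem_uciAut hφ τ⟩
  map_one' := Subtype.ext (LinearEquiv.ext fun x => Subtype.ext
    ((twist_one hφ x).trans (hφ.apply_of_mem x.2)))
  map_mul' σ τ := Subtype.ext (LinearEquiv.ext fun x => Subtype.ext (twist_mul hφ σ τ x))

theorem isExtendedAction_boundaryAction : IsExtendedAction hφ (boundaryAction hφ) where
  extends_ad g x := by
    refine Subtype.ext ?_
    have h := eq_twist hφ (R.innerHom g) (isTwisted_adCP g) x
    rw [hφ.apply_of_mem x.2, adCP_apply, hφ.apply_of_mem (ad_mem_boundary hφ g x.2)] at h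
    exact h.symm
  equivariant τ g x := Subtype.ext ((isTwisted_twist hφ τ).2.1 g x)
  fixes τ a ha := Subtype.ext ((isTwisted_twist hφ τ).2.2 a ha)

/-- A unital completely isometric map of the boundary, precomposed with `φ`, as a linear map. -/
def uciLinearMap (T : uciAut (boundary φ)) : (H →L[ℂ] H) →ₗ[ℂ] (H →L[ℂ] H) :=
  (boundary φ).subtype ∘ₗ T.1.toLinearMap ∘ₗ φ.toLinearMap.rangeRestrict

theorem norm_map_uciLinearMap (T : uciAut (boundary φ)) {k : ℕ}
    (X : CStarMatrix (Fin k) (Fin k) (H →L[ℂ] H)) : ‖X.map (uciLinearMap T)‖ = ‖X.map φ‖ :=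
  T.2.2 k (Matrix.of fun i j => ⟨φ (X i j), apply_mem_boundary φ _⟩)

/-- A unital completely isometric map of the boundary, precomposed with `φ`, is completely
positive. -/
def uciCP (hφ1 : φ 1 = 1) (T : uciAut (boundary φ)) : (H →L[ℂ] H) →CP (H →L[ℂ] H) :=
  cpOfNormMapEq φ hφ1 (uciLinearMap T) (T.2.1 ⟨φ 1, apply_mem_boundary φ 1⟩ hφ1)
    fun _ X => norm_map_uciLinearMap T X

theorem uciCP_apply (hφ1 : φ 1 = 1) (T : uciAut (boundary φ)) (x : H →L[ℂ] H) :
    uciCP hφ1 T x = T.1 ⟨φ x, apply_mem_boundary φ x⟩ := rfl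

theorem IsExtendedAction.isTwisted_uciCP {hφ : R.IsMinimalMap φ}
    {ρ : R.autGroup →* uciAut (boundary φ)} (hρ : IsExtendedAction hφ ρ) (τ : R.autGroup) :
    R.IsTwisted τ.1 (uciCP hφ.1.1 (ρ τ)) := by
  refine ⟨(ρ τ).2.1 _ hφ.1.1, fun g x => ?_, fun a ha => ?_⟩
  · rw [uciCP_apply, uciCP_apply]
    have h := congrArg Subtype.val (hρ.equivariant τ g ⟨φ x, apply_mem_boundary φ x⟩)
    refine Eq.trans ?_ h
    congr 2
    exact Subtype.ext (hφ.1.2.1 g x)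
  · rw [uciCP_apply]
    have h := congrArg Subtype.val (hρ.fixes τ a ha)
    refine Eq.trans ?_ h
    congr 2
    exact Subtype.ext (hφ.1.2.2 a ha)

/-- ρ(τ) composed with φ is a unital completely positive map twisted by τ, to which `eq_twist`
applies. -/
theorem IsExtendedAction.eq_boundaryAction {ρ : R.autGroup →* uciAut (boundary φ)}
    (hρ : IsExtendedAction hφ ρ) : ρ = boundaryAction hφ := by
  refine MonoidHom.ext fun τ => Subtype.ext (LinearEquiv.ext fun x => Subtype.ext ?_)
  have h := eq_twist hφ τ (hρ.isTwisted_uciCP τ) x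
  rw [hφ.apply_of_mem x.2, uciCP_apply, hφ.apply_of_mem (Subtype.property _)] at h
  refine Eq.trans ?_ h
  congr 2
  exact Subtype.ext (hφ.apply_of_mem x.2).symm

end CovRep

end CovariantBoundary

end

open CovariantBoundary CovRep in
theorem lemma5p2 {G A H : Type*} [Group G] [CStarAlgebra A] (α : G →* (A ≃⋆ₐ[ℂ] A))
    [NormedAddCommGroup H] [InnerProductSpace ℂ H] [CompleteSpace H] (R : CovRep α H)
    (φ : (H →L[ℂ] H) →CP (H →L[ℂ] H)) (hφ : R.IsMinimalMap φ) :
    ∃ ρ : R.autGroup →* uciAut (boundary φ),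
      IsExtendedAction hφ ρ ∧
      (∀ (τ : R.autGroup) (x y : boundary φ),
        (ρ τ).1 (choiEffrosMul φ x y) = choiEffrosMul φ ((ρ τ).1 x) ((ρ τ).1 y)) ∧
      (∀ (τ : R.autGroup) (x : boundary φ),
        (ρ τ).1 (boundaryStar φ x) = boundaryStar φ ((ρ τ).1 x)) ∧
      ∀ ρ' : R.autGroup →* uciAut (boundary φ), IsExtendedAction hφ ρ' → ρ' = ρ := by
  refine ⟨boundaryAction hφ, isExtendedAction_boundaryAction hφ, fun τ x y => Subtype.ext ?_,
    fun τ x => Subtype.ext (map_star (twist φ τ) (x : H →L[ℂ] H)),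
    fun ρ' hρ' => hρ'.eq_boundaryAction⟩
  -- The product xy is read as (x^*)^*y. The outer φ of the Choi–Effros product is absorbed by
  -- `twist_apply`.
  have h := twist_star_mul hφ τ (star_mem_boundary φ x.2) y.2
  rw [star_star, map_star, star_star] at h
  exact (twist_apply hφ τ _).trans h
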